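/- Conventions. All metric spaces carry a distance $d$; a geodesic is an isometric embedding of an interval, and a curve on an interval is a local geodesic if it is a geodesic near each parameter. For $\kappa\in\mathbb R$ let $R_\kappa\in(0,\infty]$ be the diameter of the complete simply connected surface $M^2_\kappa$ of constant curvature $\kappa$. A complete metric space is $\mathrm{CAT}(\kappa)$ if any two points at distance $<R_\kappa$ are joined by a geodesic and all triangles of perimeter $<2R_\kappa$ are not thicker than their comparison triangles in $M^2_\kappa$. A GCBA space of curvature $\le\kappa$ is a locally compact, separable metric space $X$ in which every point has a $\mathrm{CAT}(\kappa)$ neighborhood and every local geodesic $[a,b]\to X$, $a<b$, extends as a local geodesic to some larger interval $[a-\varepsilon,b+\varepsilon]$, $\varepsilon>0$. An open ball $U=B_{r_0}(x_0)$, $r_0>0$, in such a space is called a tiny ball if $r_0\le\min\{1,\tfrac1{100}R_\kappa\}$ and the closed ball $\bar B_{10 r_0}(x_0)$ is a compact $\mathrm{CAT}(\kappa)$ space. A function $f:U\to\mathbb R$ is convex if $f\circ c$ is convex for every geodesic $c$ in $U$. A curve $\gamma:I\to U$ on a compact interval $I$ is a DC-curve of norm bounded by $A$ if $\gamma$ is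 $A$-Lipschitz and, for every $1$-Lipschitz convex function $f:U\to\mathbb R$, the composition $f\circ\gamma$ is the difference of two $A$-Lipschitz convex functions on $I$. The length $\ell(\gamma)$ is the supremum of the lengths of inscribed polygons. Proposition. Let $X$ be a GCBA space of curvature $\le\kappa$, let $U\subset X$ be a tiny ball, let $I$ be a compact interval and $A\ge 0$, and let $\gamma_l:I\to U$, $l\in\mathbb N$, be DC-curves of norm bounded by $A$. If $\gamma_l$ converges pointwise on $I$ to a curve $\gamma:I\to X$, then $\lim_{l\to\infty}\ell(\gamma_l)=\ell(\gamma)$. -/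

import Mathlib

open Set Filter Topology
open scoped NNReal ENNReal

noncomputable section

namespace GCBA

/-- The diameter `R_κ ∈ (0, ∞]` of the complete simply connected surface of constant
curvature `κ`. -/
def modelDiam (κ : ℝ) : ℝ≥0∞ :=
  if 0 < κ then ENNReal.ofReal (Real.pi / Real.sqrt κ) else ⊤

section

variable {X : Type*} [MetricSpace X]

/-- `γ` restricted to `I` is an isometric embedding (for an interval `I`: a geodesic). -/
def IsGeodesicOn (γ : ℝ → X) (I : Set ℝ) : Prop :=
  ∀ s ∈ I, ∀ t ∈ I, dist (γ s) (γ t) = |s - t|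

/-- `γ` restricted to the interval `I` is a local geodesic: near each `t ∈ I` (relatively
to `I`) it is a geodesic. -/
def IsLocalGeodesicOn (γ : ℝ → X) (I : Set ℝ) : Prop :=
  ∀ t ∈ I, ∃ ε > 0, IsGeodesicOn γ (I ∩ Ioo (t - ε) (t + ε))

/-- `c`, restricted to `[0, d(x,y)]`, is a geodesic from `x` to `y` contained in `Y`. -/
structure IsGeodesicFromTo (Y : Set X) (c : ℝ → X) (x y : X) : Prop where
  geodesic : IsGeodesicOn c (Icc 0 (dist x y))
  mapsTo : MapsTo c (Icc 0 (dist x y)) Y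
  source : c 0 = x
  target : c (dist x y) = y

/-- Triangles in `Y` of perimeter `< 2 R` are not thicker than their comparison triangles in
the model surface `M` with distance `dM`. Here `p = c₁ s` and `q = c₂ t` are arbitrary points
on the two sides issuing from `x`, and `p'`, `q'` are the corresponding points of the
comparison triangle `x' y' z'`; the other pairs of sides are covered by relabelling the
vertices, and two points on the same side cause no condition. -/
def ThinTriangles {M : Type} (dM : M → M → ℝ) (R : ℝ≥0∞) (Y : Set X) : Prop :=
  ∀ x ∈ Y, ∀ y ∈ Y, ∀ z ∈ Y, edist x y + edist y z + edist z x < 2 * R →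
    ∃ x' y' z' : M, dM x' y' = dist x y ∧ dM y' z' = dist y z ∧ dM z' x' = dist z x ∧
      ∀ c₁ c₂ : ℝ → X, IsGeodesicFromTo Y c₁ x y → IsGeodesicFromTo Y c₂ x z →
        ∀ s ∈ Icc 0 (dist x y), ∀ t ∈ Icc 0 (dist x z), ∀ p' q' : M,
          dM x' p' = s → dM p' y' = dist x y - s →
          dM x' q' = t → dM q' z' = dist x z - t →
            dist (c₁ s) (c₂ t) ≤ dM p' q'

/-- The subset `Y`, with the restricted metric, is a `CAT(κ)` space. The model surface is the
unit sphere with the angular metric divided by `√κ` if `κ > 0`, the Euclidean plane if `κ = 0`,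
and the hyperbolic plane with its metric divided by `√(-κ)` if `κ < 0`. -/
structure IsCAT (κ : ℝ) (Y : Set X) : Prop where
  complete : IsComplete Y
  exists_geodesic : ∀ x ∈ Y, ∀ y ∈ Y, edist x y < modelDiam κ →
    ∃ c : ℝ → X, IsGeodesicFromTo Y c x y
  thin_of_pos : 0 < κ → ThinTriangles
    (fun u v : Metric.sphere (0 : EuclideanSpace ℝ (Fin 3)) 1 =>
      InnerProductGeometry.angle (u : EuclideanSpace ℝ (Fin 3)) v / Real.sqrt κ)
    (modelDiam κ) Y
  thin_of_zero : κ = 0 → ThinTriangles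
    (fun u v : EuclideanSpace ℝ (Fin 2) => dist u v) (modelDiam κ) Y
  thin_of_neg : κ < 0 → ThinTriangles
    (fun u v : UpperHalfPlane => dist u v / Real.sqrt (-κ)) (modelDiam κ) Y

variable (X) in
/-- `X` has curvature bounded above by `κ`: every point has a `CAT(κ)` neighbourhood. -/
def CurvatureLE (κ : ℝ) : Prop :=
  ∀ x : X, ∃ Y ∈ 𝓝 x, IsCAT κ Y

variable (X) in
/-- Every local geodesic on a compact interval extends, as a local geodesic, to a larger
interval. -/
def LocallyGeodesicallyComplete : Prop :=
  ∀ (a b : ℝ) (γ : ℝ → X), a < b → IsLocalGeodesicOn γ (Icc a b) →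
    ∃ ε > 0, ∃ γ' : ℝ → X, EqOn γ' γ (Icc a b) ∧
      IsLocalGeodesicOn γ' (Icc (a - ε) (b + ε))

variable (X) in
/-- `X` is a GCBA space of curvature `≤ κ`. -/
structure IsGCBA (κ : ℝ) : Prop where
  locallyCompact : LocallyCompactSpace X
  separable : TopologicalSpace.SeparableSpace X
  curvatureLE : CurvatureLE X κ
  locallyGeodesicallyComplete : LocallyGeodesicallyComplete X

/-- The open ball of radius `r₀` around `x₀` is a tiny ball (with respect to the curvature
bound `κ`): the radius is at most `min {1, R_κ / 100}` and the concentric closed ball of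
radius `10 r₀` is a compact `CAT(κ)` space. -/
structure IsTinyBall (κ : ℝ) (x₀ : X) (r₀ : ℝ) : Prop where
  pos : 0 < r₀
  le_one : r₀ ≤ 1
  le_modelDiam : ENNReal.ofReal r₀ ≤ modelDiam κ / 100
  compact : IsCompact (Metric.closedBall x₀ (10 * r₀))
  cat : IsCAT κ (Metric.closedBall x₀ (10 * r₀))

/-- `f` is convex on `U` (with the restricted metric): its restriction to every geodesic
contained in `U` is convex. -/
def GeodConvexOn (U : Set X) (f : X → ℝ) : Prop :=
  ∀ (a b : ℝ) (c : ℝ → X), IsGeodesicOn c (Icc a b) → MapsTo c (Icc a b) U →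
    ConvexOn ℝ (Icc a b) (f ∘ c)

/-- `γ : [a,b] → U` is a DC-curve of norm bounded by `A`. -/
structure IsDCCurve (U : Set X) (A : ℝ≥0) (a b : ℝ) (γ : ℝ → X) : Prop where
  mapsTo : MapsTo γ (Icc a b) U
  lipschitz : LipschitzOnWith A γ (Icc a b)
  dc : ∀ f : X → ℝ, LipschitzOnWith 1 f U → GeodConvexOn U f →
    ∃ g h : ℝ → ℝ,
      ConvexOn ℝ (Icc a b) g ∧ LipschitzOnWith A g (Icc a b) ∧
      ConvexOn ℝ (Icc a b) h ∧ LipschitzOnWith A h (Icc a b) ∧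
      ∀ t ∈ Icc a b, f (γ t) = g t - h t

/-- The length of the curve `γ : [a,b] → X`, the supremum of the lengths of inscribed
polygons. -/
def curveLength (γ : ℝ → X) (a b : ℝ) : ℝ≥0∞ := eVariationOn γ (Icc a b)

end

end GCBA

end

/-! Length is lower semicontinuous under pointwise convergence, so the issue is to exclude a loss of
length in the limit. It suffices that inscribed polygons on one fixed fine partition approximate
`ℓ(γ_l)` up to a small error uniform in `l`: for a fixed partition the polygon lengths converge, and
the limiting polygon is no longer than `γ`.

Two facts give the uniformity. First, for every `ε` there is a finite set `P` such that any distinct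
`x`, `y` in the tiny ball satisfy `|d(p,x) - d(p,y)| ≥ (1-ε) d(x,y)` for some `p ∈ P`
(`exists_finset_le_abs_dist_sub`). To see this, prolong the geodesic `xy` beyond `y` by `r₀` to a
point `z`, take `p` close to `z`, and use convexity of `d(p,·)` along `xz`. Both the prolongation
and this step rest on convexity of distance functions at scales below `R_κ/2`, which follows from
midpoint convexity in the model surfaces.

Second, each `d(p,·)` is convex and `1`-Lipschitz, so along `γ_l` it is a difference of two
`A`-Lipschitz convex functions. Slopes of convex functions are monotone, hence their oscillations
over the intervals of a partition sum to at most `8A`, whatever the partition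
(`exists_slope_oscillation_bound`). With mesh `d`, the polygon then misses `(1-ε) ℓ(γ_l)` by at most
`d * |P| * 8A` (`eVariationOn_le_sum_dist_add`). -/

/-! ### Midpoint convexity of the distance in the curved model surfaces -/

namespace InnerProductGeometry

/-- The spherical midpoint of two directions at an angle at most `π / 2`, together with the
midpoint convexity of the angle to a third direction. -/
theorem exists_midpoint_angle_le {E : Type*} [NormedAddCommGroup E] [InnerProductSpace ℝ E]
    {u v w : E} (hu : ‖u‖ = 1) (hv : ‖v‖ = 1) (hw : ‖w‖ = 1)
    (huv : angle u v ≤ Real.pi / 2) (hvw : angle v w ≤ Real.pi / 2)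
    (hwu : angle w u ≤ Real.pi / 2) :
    ∃ m : E, ‖m‖ = 1 ∧ angle u m = angle u w / 2 ∧ angle m w = angle u w / 2 ∧
      angle v m ≤ (angle u v + angle v w) / 2 := by
  have hpi := Real.pi_pos
  rw [angle_comm] at hwu
  have h1 := angle_le_angle_add_angle u w v
  have h2 := angle_le_angle_add_angle v u w
  rw [angle_comm w v] at h1
  rw [angle_comm v u] at h2
  have cos_eq : ∀ {x y : E}, ‖x‖ = 1 → ‖y‖ = 1 → inner ℝ x y = Real.cos (angle x y) := by
    intro x y hx hy
    rw [cos_angle, hx, hy]; simp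
  have angle_eq : ∀ {x y : E}, ‖x‖ = 1 → ‖y‖ = 1 → angle x y = Real.arccos (inner ℝ x y) := by
    intro x y hx hy
    rw [angle, hx, hy]; simp
  have iuw := cos_eq hu hw
  have iuv := cos_eq hu hv
  have ivw := cos_eq hv hw
  have huv0 := angle_nonneg u v
  have hvw0 := angle_nonneg v w
  have huw0 := angle_nonneg u w
  set α := angle u v
  set β := angle v w
  set θ := angle u w
  have hc : 0 < Real.cos (θ / 2) := Real.cos_pos_of_mem_Ioo ⟨by linarith, by linarith⟩
  have hcθ : Real.cos θ = 2 * Real.cos (θ / 2) ^ 2 - 1 := by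
    rw [← Real.cos_two_mul]; congr 1; ring
  have huu : inner ℝ u u = 1 := by rw [real_inner_self_eq_norm_sq, hu]; norm_num
  have hww : inner ℝ w w = 1 := by rw [real_inner_self_eq_norm_sq, hw]; norm_num
  have hnorm : ‖u + w‖ = 2 * Real.cos (θ / 2) := by
    have : ‖u + w‖ ^ 2 = (2 * Real.cos (θ / 2)) ^ 2 := by
      rw [norm_add_sq_real, hu, hw, iuw, hcθ]; ring
    exact (sq_eq_sq₀ (norm_nonneg _) (by positivity)).1 this
  have hm : ‖(2 * Real.cos (θ / 2))⁻¹ • (u + w)‖ = 1 := by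
    rw [norm_smul, hnorm, Real.norm_of_nonneg (by positivity)]
    exact inv_mul_cancel₀ (by positivity)
  have harc : Real.arccos (Real.cos (θ / 2)) = θ / 2 :=
    Real.arccos_cos (by linarith) (by linarith)
  refine ⟨(2 * Real.cos (θ / 2))⁻¹ • (u + w), hm, ?_, ?_, ?_⟩
  · rw [angle_eq hu hm, inner_smul_right, inner_add_right, huu, iuw, hcθ]
    rw [← harc]
    congr 1
    rw [harc]
    field_simp
    ring
  · rw [angle_eq hm hw, inner_smul_left, inner_add_left, hww, iuw, hcθ]
    rw [← harc]
    congr 1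
    rw [harc]
    simp only [map_inv₀, map_mul, conj_trivial]
    field_simp
    ring
  · rw [angle_eq hv hm, inner_smul_right, inner_add_right, real_inner_comm, iuv, ivw]
    rw [← Real.arccos_cos (x := (α + β) / 2) (by linarith) (by linarith)]
    apply Real.arccos_le_arccos
    have hsum : Real.cos α + Real.cos β
        = 2 * Real.cos ((α + β) / 2) * Real.cos ((α - β) / 2) := Real.cos_add_cos α β
    rw [hsum]
    -- The triangle inequality gives `|α - β| ≤ θ`, so replacing `cos ((α - β) / 2)` by `cos (θ /
    -- 2)` cancels the normalization of `m`.
    have hle : Real.cos (θ / 2) ≤ Real.cos ((α - β) / 2) := by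
      rw [← Real.cos_abs ((α - β) / 2)]
      apply Real.cos_le_cos_of_nonneg_of_le_pi (abs_nonneg _) (by linarith)
      rw [abs_le]
      constructor <;> linarith
    have hpos : 0 ≤ Real.cos ((α + β) / 2) :=
      Real.cos_nonneg_of_mem_Icc ⟨by linarith, by linarith⟩
    rw [inv_mul_eq_div, le_div_iff₀ (by positivity)]
    nlinarith

end InnerProductGeometry

namespace UpperHalfPlane

/-- The hyperbolic midpoint, together with the midpoint convexity of the distance to a point. -/
theorem exists_midpoint_dist_le (u v w : UpperHalfPlane) :
    ∃ m : UpperHalfPlane, dist u m = dist u w / 2 ∧ dist m w = dist u w / 2 ∧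
      dist v m ≤ (dist u v + dist v w) / 2 := by
  set θ := dist u w with hθ
  set C := Real.cosh (θ / 2) with hC
  have hC0 : 0 < C := Real.cosh_pos _
  have hCθ : Real.cosh θ = 2 * C ^ 2 - 1 := by
    have h := Real.cosh_two_mul (θ / 2)
    have h' := Real.cosh_sq (θ / 2)
    rw [show 2 * (θ / 2) = θ by ring] at h
    rw [h, hC]; linarith
  have hu := u.im_pos
  have hv := v.im_pos
  have hw := w.im_pos
  have huw := cosh_dist' u w
  rw [← hθ, hCθ] at huw
  have huv := cosh_dist' u v
  have hvw := cosh_dist' v w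
  have hkey : (u.re - w.re) ^ 2 + u.im ^ 2 + w.im ^ 2 = (2 * C ^ 2 - 1) * (2 * u.im * w.im) := by
    rw [huw]; field_simp
  have hS : 0 < u.im + w.im := by linarith
  have him : 0 < 2 * C * u.im * w.im / (u.im + w.im) := by positivity
  -- This is `(u + w) / (2C)` of the hyperboloid model in half-plane coordinates; `hcosh` below is
  -- that linear formula.
  let m : UpperHalfPlane :=
    ⟨⟨(u.re * w.im + w.re * u.im) / (u.im + w.im), 2 * C * u.im * w.im / (u.im + w.im)⟩, him⟩
  have hmre : m.re = (u.re * w.im + w.re * u.im) / (u.im + w.im) := rfl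
  have hmim : m.im = 2 * C * u.im * w.im / (u.im + w.im) := rfl
  have hcosh : ∀ p : UpperHalfPlane,
      Real.cosh (dist p m) = (Real.cosh (dist p u) + Real.cosh (dist p w)) / (2 * C) := by
    intro p
    have hp := p.im_pos
    rw [cosh_dist' p m, cosh_dist' p u, cosh_dist' p w, hmre, hmim]
    field_simp
    linear_combination (-u.im * w.im) * hkey
  have half : ∀ x : ℝ, 0 ≤ x → Real.cosh x = C → x = θ / 2 := by
    intro x hx h
    have := Real.cosh_le_cosh (x := x) (y := θ / 2)
    have h0 : 0 ≤ θ / 2 := by positivity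
    have h1 := Real.cosh_le_cosh (x := θ / 2) (y := x)
    rw [abs_of_nonneg hx, abs_of_nonneg h0] at this h1
    exact le_antisymm (this.1 h.le) (h1.1 h.ge)
  refine ⟨m, half _ dist_nonneg ?_, half _ dist_nonneg ?_, ?_⟩
  · rw [hcosh, dist_self, Real.cosh_zero, ← hθ, hCθ]
    field_simp; ring
  · rw [dist_comm, hcosh, dist_self, Real.cosh_zero, dist_comm w u, ← hθ, hCθ]
    field_simp; ring
  · have h1 : |dist u v - dist v w| ≤ θ := by
      rw [abs_le]
      have e1 := dist_triangle v u w
      have e2 := dist_triangle u w v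
      rw [dist_comm v u] at e1
      rw [dist_comm w v] at e2
      constructor <;> linarith
    rw [← abs_of_nonneg (dist_nonneg (x := v) (y := m)),
      ← abs_of_nonneg (show 0 ≤ (dist u v + dist v w) / 2 by positivity), ← Real.cosh_le_cosh,
      hcosh, dist_comm v u]
    set α := dist u v
    set β := dist v w
    have hsum : Real.cosh α + Real.cosh β
        = 2 * Real.cosh ((α + β) / 2) * Real.cosh ((α - β) / 2) := by
      have e1 := Real.cosh_add ((α + β) / 2) ((α - β) / 2)
      have e2 := Real.cosh_sub ((α + β) / 2) ((α - β) / 2)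
      rw [show (α + β) / 2 + (α - β) / 2 = α by ring] at e1
      rw [show (α + β) / 2 - (α - β) / 2 = β by ring] at e2
      rw [e1, e2]; ring
    have hle : Real.cosh ((α - β) / 2) ≤ C := by
      rw [hC, Real.cosh_le_cosh, abs_div, abs_div, abs_of_nonneg (dist_nonneg : 0 ≤ θ)]
      have : |(2 : ℝ)| = 2 := abs_two
      rw [this]; linarith
    have := Real.cosh_pos ((α + β) / 2)
    rw [hsum, div_le_iff₀ (by positivity)]
    nlinarith

end UpperHalfPlane

/-! ### Convexity of distance functions on tiny balls -/

/-- A continuous midpoint convex function on a compact interval is convex. -/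
theorem convexOn_Icc_of_midpoint_le {a b : ℝ} {f : ℝ → ℝ} (hf : ContinuousOn f (Icc a b))
    (hmid : ∀ s ∈ Icc a b, ∀ t ∈ Icc a b, f ((s + t) / 2) ≤ (f s + f t) / 2) :
    ConvexOn ℝ (Icc a b) f := by
  refine LinearOrder.convexOn_of_lt (convex_Icc a b) ?_
  intro x hx y hy hxy l μ hl hμ hlμ
  have hsub : Icc x y ⊆ Icc a b := Icc_subset_Icc hx.1 hy.2
  set k := (f y - f x) / (y - x) with hk
  have hyx : 0 < y - x := sub_pos.2 hxy
  have hkk : k * (y - x) = f y - f x := by rw [hk]; field_simp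
  set g : ℝ → ℝ := fun r => f r - (f x + k * (r - x)) with hg
  have hgx : g x = 0 := by simp [hg]
  have hgy : g y = 0 := by simp only [hg]; linarith
  have hgc : ContinuousOn g (Icc x y) := (hf.mono hsub).sub (by fun_prop)
  have hgm : ∀ s ∈ Icc x y, ∀ t ∈ Icc x y, g ((s + t) / 2) ≤ (g s + g t) / 2 := by
    intro s hs t ht
    have := hmid s (hsub hs) t (hsub ht)
    simp only [hg]
    linarith
  have hgle : ∀ r ∈ Icc x y, g r ≤ 0 := by
    obtain ⟨r₁, hr₁, hmax⟩ := isCompact_Icc.exists_isMaxOn (nonempty_Icc.2 hxy.le) hgc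
    by_contra hcon
    push Not at hcon
    obtain ⟨r₂, hr₂, hpos⟩ := hcon
    have hM : 0 < g r₁ := hpos.trans_le (hmax hr₂)
    have hK : IsCompact (Icc x y ∩ g ⁻¹' {g r₁}) :=
      isCompact_Icc.of_isClosed_subset
        (hgc.preimage_isClosed_of_isClosed isClosed_Icc isClosed_singleton) inter_subset_left
    -- At the leftmost maximizer, a symmetric step has a strictly smaller value on the left,
    -- contradicting midpoint convexity.
    obtain ⟨r, ⟨hr, hgr⟩, hleast⟩ := hK.exists_isLeast ⟨r₁, hr₁, rfl⟩
    have hgr : g r = g r₁ := hgr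
    have hrx : x < r := lt_of_le_of_ne hr.1 (by rintro rfl; linarith)
    have hry : r < y := lt_of_le_of_ne hr.2 (by rintro rfl; linarith)
    set δ := min (r - x) (y - r) with hδ
    have hδ0 : 0 < δ := lt_min (by linarith) (by linarith)
    have hδ1 : δ ≤ r - x := min_le_left _ _
    have hδ2 : δ ≤ y - r := min_le_right _ _
    have hm1 : r - δ ∈ Icc x y := ⟨by linarith, by linarith⟩
    have hm2 : r + δ ∈ Icc x y := ⟨by linarith, by linarith⟩
    have h1 : g (r - δ) < g r₁ := by
      refine lt_of_le_of_ne (hmax hm1) fun h => ?_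
      have := hleast ⟨hm1, h⟩
      linarith
    have h2 : g (r + δ) ≤ g r₁ := hmax hm2
    have h3 := hgm _ hm1 _ hm2
    rw [show (r - δ + (r + δ)) / 2 = r by ring] at h3
    linarith
  have hz : l • x + μ • y ∈ Icc x y := by
    simp only [smul_eq_mul]
    obtain rfl : l = 1 - μ := by linarith
    constructor <;> nlinarith
  have := hgle _ hz
  simp only [hg, smul_eq_mul] at this ⊢
  obtain rfl : l = 1 - μ := by linarith
  have e : k * ((1 - μ) * x + μ * y - x) = μ * (f y - f x) := by rw [← hkk]; ring
  rw [e] at this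
  linarith

namespace GCBA

variable {X : Type*} [MetricSpace X]

theorem IsGeodesicOn.mono {γ : ℝ → X} {I J : Set ℝ} (h : IsGeodesicOn γ I) (hJ : J ⊆ I) :
    IsGeodesicOn γ J := fun s hs t ht => h s (hJ hs) t (hJ ht)

theorem IsGeodesicOn.continuousOn {γ : ℝ → X} {I : Set ℝ} (h : IsGeodesicOn γ I) :
    ContinuousOn γ I := by
  refine LipschitzOnWith.continuousOn (K := 1) (LipschitzOnWith.of_dist_le_mul ?_)
  intro s hs t ht
  rw [h s hs t ht, Real.dist_eq]; simp

theorem IsGeodesicOn.isGeodesicFromTo {Y : Set X} {c : ℝ → X} {a b s t : ℝ}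
    (hc : IsGeodesicOn c (Icc a b)) (hY : MapsTo c (Icc a b) Y) (has : a ≤ s) (hst : s ≤ t)
    (htb : t ≤ b) : IsGeodesicFromTo Y (fun r => c (s + r)) (c s) (c t) := by
  have hd : dist (c s) (c t) = t - s := by
    rw [hc s ⟨has, hst.trans htb⟩ t ⟨has.trans hst, htb⟩, abs_sub_comm,
      abs_of_nonneg (sub_nonneg.2 hst)]
  have hmem : ∀ r ∈ Icc 0 (dist (c s) (c t)), s + r ∈ Icc a b := by
    intro r hr
    rw [hd] at hr
    exact ⟨by linarith [hr.1], by linarith [hr.2]⟩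
  refine ⟨fun r hr r' hr' => ?_, fun r hr => hY (hmem r hr), by simp, ?_⟩
  · rw [hc _ (hmem r hr) _ (hmem r' hr')]; congr 1; ring
  · rw [hd]; congr 1; ring

/-- If distances to a point are midpoint convex in the model surface, at scale at most `D`,
then they are so in a space with thin triangles. -/
theorem ThinTriangles.dist_midpoint_le {M : Type} {dM : M → M → ℝ} {R : ℝ≥0∞} {Y : Set X}
    (hT : ThinTriangles dM R Y) (hsymm : ∀ u v, dM u v = dM v u) (hself : ∀ u, dM u u = 0)
    {D : ℝ}
    (hmid : ∀ u v w, dM u v ≤ D → dM v w ≤ D → dM w u ≤ D →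
      ∃ m, dM u m = dM u w / 2 ∧ dM m w = dM u w / 2 ∧ dM v m ≤ (dM u v + dM v w) / 2)
    {x p z : X} (hx : x ∈ Y) (hp : p ∈ Y) (hz : z ∈ Y)
    (hxp : dist x p ≤ D) (hpz : dist p z ≤ D) (hzx : dist z x ≤ D)
    (hper : edist x p + edist p z + edist z x < 2 * R)
    {c₁ c₂ : ℝ → X} (h₁ : IsGeodesicFromTo Y c₁ x p) (h₂ : IsGeodesicFromTo Y c₂ x z) :
    dist p (c₂ (dist x z / 2)) ≤ (dist x p + dist p z) / 2 := by
  obtain ⟨x', p', z', e₁, e₂, e₃, H⟩ := hT x hx p hp z hz hper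
  obtain ⟨m, m₁, m₂, m₃⟩ := hmid x' p' z' (e₁.le.trans hxp) (e₂.le.trans hpz) (e₃.le.trans hzx)
  have e₃' : dM x' z' = dist x z := by rw [hsymm, e₃, dist_comm]
  have h0 := dist_nonneg (x := x) (y := z)
  -- The point on the side `xp` is taken to be the vertex `p` itself, the other one the midpoint of
  -- `xz`.
  have := H c₁ c₂ h₁ h₂ (dist x p) ⟨dist_nonneg, le_rfl⟩ (dist x z / 2)
    ⟨by linarith, by linarith⟩ p' m e₁ (by rw [hself]; ring) (by rw [m₁, e₃'])
    (by rw [m₂, e₃']; ring)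
  rw [h₁.target] at this
  rw [e₁, e₂] at m₃
  exact this.trans m₃

/-- For `κ > 0` the bound `D ≤ R_κ / 2` plays two roles: it keeps the perimeter below `2 R_κ`, and
it makes the sides of the spherical comparison triangle at most `π / 2`. -/
theorem IsCAT.dist_midpoint_le {κ : ℝ} {Y : Set X} (hY : IsCAT κ Y) {D : ℝ}
    (hD : 0 < κ → D ≤ Real.pi / Real.sqrt κ / 2)
    {x p z : X} (hx : x ∈ Y) (hp : p ∈ Y) (hz : z ∈ Y)
    (hxp : dist x p ≤ D) (hpz : dist p z ≤ D) (hzx : dist z x ≤ D)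
    {c : ℝ → X} (hc : IsGeodesicFromTo Y c x z) :
    dist p (c (dist x z / 2)) ≤ (dist x p + dist p z) / 2 := by
  have hfin : edist x p + edist p z + edist z x < 2 * modelDiam κ ∧ edist x p < modelDiam κ := by
    unfold modelDiam
    split_ifs with hκ
    · have hρ : 0 < Real.pi / Real.sqrt κ := div_pos Real.pi_pos (Real.sqrt_pos.2 hκ)
      have hD' := hD hκ
      set ρ := Real.pi / Real.sqrt κ
      constructor
      · rw [edist_dist, edist_dist, edist_dist, ← ENNReal.ofReal_add dist_nonneg dist_nonneg,
          ← ENNReal.ofReal_add (by positivity) dist_nonneg,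
          show (2 : ℝ≥0∞) = ENNReal.ofReal 2 by simp, ← ENNReal.ofReal_mul (by norm_num)]
        exact (ENNReal.ofReal_lt_ofReal_iff (by positivity)).2 (by linarith)
      · rw [edist_dist]
        exact (ENNReal.ofReal_lt_ofReal_iff hρ).2 (by linarith)
    · constructor
      · rw [ENNReal.mul_top (by norm_num)]
        simp [ENNReal.add_lt_top, edist_lt_top]
      · exact edist_lt_top _ _
  obtain ⟨hper, hlt⟩ := hfin
  obtain ⟨c₁, hc₁⟩ := hY.exists_geodesic x hx p hp hlt
  rcases lt_trichotomy κ 0 with hκ | hκ | hκ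
  · refine (hY.thin_of_neg hκ).dist_midpoint_le (D := D) (fun u v => by rw [dist_comm])
      (fun u => by simp) ?_ hx hp hz hxp hpz hzx hper hc₁ hc
    intro u v w _ _ _
    have hs : 0 < Real.sqrt (-κ) := Real.sqrt_pos.2 (by linarith)
    obtain ⟨m, m₁, m₂, m₃⟩ := UpperHalfPlane.exists_midpoint_dist_le u v w
    refine ⟨m, by simp only [m₁]; ring, by simp only [m₂]; ring, ?_⟩
    calc dist v m / Real.sqrt (-κ) ≤ ((dist u v + dist v w) / 2) / Real.sqrt (-κ) := by gcongr
      _ = _ := by ring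
  · refine (hY.thin_of_zero hκ).dist_midpoint_le (D := D) dist_comm dist_self ?_
      hx hp hz hxp hpz hzx hper hc₁ hc
    intro u v w _ _ _
    refine ⟨midpoint ℝ u w, ?_, ?_, ?_⟩
    · rw [dist_left_midpoint (𝕜 := ℝ)]; norm_num; ring
    · rw [dist_midpoint_right (𝕜 := ℝ)]; norm_num; ring
    · have := dist_midpoint_midpoint_le v v u w
      rw [midpoint_self, dist_comm v u] at this
      exact this
  · have hs : 0 < Real.sqrt κ := Real.sqrt_pos.2 hκ
    refine (hY.thin_of_pos hκ).dist_midpoint_le (D := D)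
      (fun u v => by rw [InnerProductGeometry.angle_comm]) (fun u => ?_) ?_
      hx hp hz hxp hpz hzx hper hc₁ hc
    · rw [InnerProductGeometry.angle_self (ne_zero_of_mem_unit_sphere u), zero_div]
    intro u v w h₁ h₂ h₃
    have scale : ∀ θ : ℝ, θ / Real.sqrt κ ≤ D → θ ≤ Real.pi / 2 := by
      intro θ h
      have := h.trans (hD hκ)
      rw [show Real.pi / Real.sqrt κ / 2 = Real.pi / 2 / Real.sqrt κ by ring,
        div_le_div_iff_of_pos_right hs] at this
      exact this
    obtain ⟨m, m₀, m₁, m₂, m₃⟩ := InnerProductGeometry.exists_midpoint_angle_le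
      (norm_eq_of_mem_sphere u) (norm_eq_of_mem_sphere v) (norm_eq_of_mem_sphere w)
      (scale _ h₁) (scale _ h₂) (scale _ h₃)
    refine ⟨⟨m, by simpa using m₀⟩, by simp only [m₁]; ring, by simp only [m₂]; ring, ?_⟩
    calc InnerProductGeometry.angle (v : EuclideanSpace ℝ (Fin 3)) m / Real.sqrt κ
        ≤ ((InnerProductGeometry.angle (u : EuclideanSpace ℝ (Fin 3)) v
          + InnerProductGeometry.angle (v : EuclideanSpace ℝ (Fin 3)) w) / 2) / Real.sqrt κ := by
            gcongr
      _ = _ := by ring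

/-- In a `CAT(κ)` space of diameter at most `R_κ / 2`, the distance functions are convex. -/
theorem IsCAT.convexOn_dist {κ : ℝ} {Y : Set X} (hY : IsCAT κ Y) {D : ℝ}
    (hD : 0 < κ → D ≤ Real.pi / Real.sqrt κ / 2)
    (hdiam : ∀ x ∈ Y, ∀ y ∈ Y, dist x y ≤ D) {p : X} (hp : p ∈ Y)
    {a b : ℝ} {c : ℝ → X} (hc : IsGeodesicOn c (Icc a b)) (hcY : MapsTo c (Icc a b) Y) :
    ConvexOn ℝ (Icc a b) (fun t => dist p (c t)) := by
  apply convexOn_Icc_of_midpoint_le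
  · exact (continuous_const.dist continuous_id).comp_continuousOn hc.continuousOn
  intro s hs t ht
  wlog hst : s ≤ t generalizing s t
  · have := this t ht s hs (le_of_not_ge hst)
    rwa [add_comm t s, add_comm (dist p (c t))] at this
  have h := hY.dist_midpoint_le hD (hcY hs) hp (hcY ht) (hdiam _ (hcY hs) _ hp)
    (hdiam _ hp _ (hcY ht)) (hdiam _ (hcY ht) _ (hcY hs))
    (hc.isGeodesicFromTo hcY hs.1 hst ht.2)
  have hd : dist (c s) (c t) = t - s := by
    rw [hc s hs t ht, abs_sub_comm, abs_of_nonneg (sub_nonneg.2 hst)]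
  rw [hd, dist_comm (c s) p] at h
  rwa [show s + (t - s) / 2 = (s + t) / 2 by ring] at h

namespace IsTinyBall

variable {κ : ℝ} {x₀ : X} {r₀ : ℝ}

/-- Here `20 * r₀` bounds the diameter of the closed ball of radius `10 * r₀`. -/
theorem radius_le (hU : IsTinyBall κ x₀ r₀) (hκ : 0 < κ) :
    20 * r₀ ≤ Real.pi / Real.sqrt κ / 2 := by
  have h := hU.le_modelDiam
  have hρ : 0 < Real.pi / Real.sqrt κ := div_pos Real.pi_pos (Real.sqrt_pos.2 hκ)
  rw [modelDiam, if_pos hκ, show (100 : ℝ≥0∞) = ENNReal.ofReal 100 by simp,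
    ← ENNReal.ofReal_div_of_pos (by norm_num), ENNReal.ofReal_le_ofReal_iff (by positivity)] at h
  linarith

theorem dist_le (x : X) (hx : x ∈ Metric.closedBall x₀ (10 * r₀)) (y : X)
    (hy : y ∈ Metric.closedBall x₀ (10 * r₀)) : dist x y ≤ 20 * r₀ := by
  have := dist_triangle_right x y x₀
  rw [Metric.mem_closedBall] at hx hy
  linarith

theorem convexOn_dist (hU : IsTinyBall κ x₀ r₀) {p : X}
    (hp : p ∈ Metric.closedBall x₀ (10 * r₀)) {a b : ℝ} {c : ℝ → X}
    (hc : IsGeodesicOn c (Icc a b))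
    (hcY : MapsTo c (Icc a b) (Metric.closedBall x₀ (10 * r₀))) :
    ConvexOn ℝ (Icc a b) (fun t => dist p (c t)) :=
  hU.cat.convexOn_dist hU.radius_le dist_le hp hc hcY

/-- Makes these functions admissible tests for DC-curves. The base point may lie outside the tiny
ball, as prolonged geodesics leave it. -/
theorem geodConvexOn_dist (hU : IsTinyBall κ x₀ r₀) {p : X}
    (hp : p ∈ Metric.closedBall x₀ (10 * r₀)) :
    GeodConvexOn (Metric.ball x₀ r₀) (fun x => dist p x) := fun _ _ _ hc hcU =>
  hU.convexOn_dist hp hc fun _ ht =>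
    Metric.ball_subset_closedBall.trans
      (Metric.closedBall_subset_closedBall (by linarith [hU.pos])) (hcU ht)

theorem exists_geodesic (hU : IsTinyBall κ x₀ r₀) {x y : X}
    (hx : x ∈ Metric.closedBall x₀ (10 * r₀)) (hy : y ∈ Metric.closedBall x₀ (10 * r₀)) :
    ∃ c : ℝ → X, IsGeodesicFromTo (Metric.closedBall x₀ (10 * r₀)) c x y := by
  refine hU.cat.exists_geodesic x hx y hy ?_
  unfold modelDiam
  split_ifs with hκ
  · rw [edist_dist]
    have := hU.radius_le hκ
    have := dist_le x hx y hy
    exact (ENNReal.ofReal_lt_ofReal_iff (by linarith [hU.pos])).2 (by linarith [hU.pos])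
  · exact edist_lt_top _ _

end IsTinyBall

end GCBA

/-! ### Prolonging geodesics, and almost recovering the metric from finitely many distances -/

namespace GCBA

variable {X : Type*} [MetricSpace X]

/-- Two geodesics whose lengths add up to the distance of the endpoints concatenate to a
geodesic. -/
theorem IsGeodesicFromTo.exists_concat {Y : Set X} {c₁ c₂ : ℝ → X} {x y z : X}
    (h₁ : IsGeodesicFromTo Y c₁ x y) (h₂ : IsGeodesicFromTo Y c₂ y z)
    (hadd : dist x z = dist x y + dist y z) :
    ∃ c : ℝ → X, IsGeodesicFromTo Y c x z ∧ c (dist x y) = y := by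
  classical
  set L := dist x y with hL
  have hL0 : 0 ≤ L := dist_nonneg
  have hr0 : 0 ≤ dist y z := dist_nonneg
  set c : ℝ → X := fun t => if t ≤ L then c₁ t else c₂ (t - L) with hc
  have hc1 : ∀ t ≤ L, c t = c₁ t := fun t ht => if_pos ht
  have hc2 : ∀ t, L ≤ t → c t = c₂ (t - L) := by
    intro t ht
    rcases ht.eq_or_lt with rfl | ht
    · rw [hc1 _ le_rfl, h₁.target, sub_self, h₂.source]
    · exact if_neg (not_le.2 ht)
  have hmem1 : ∀ {t}, 0 ≤ t → t ≤ L → t ∈ Icc 0 (dist x y) := fun h h' => ⟨h, h'⟩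
  have hmem2 : ∀ {t}, L ≤ t → t ≤ dist x z → t - L ∈ Icc 0 (dist y z) :=
    fun h h' => ⟨by linarith, by linarith⟩
  have hgeo : ∀ s t, 0 ≤ s → s ≤ t → t ≤ dist x z → dist (c s) (c t) = t - s := by
    intro s t hs hst ht
    rcases le_total t L with htL | htL
    · rw [hc1 s (hst.trans htL), hc1 t htL, h₁.geodesic _ (hmem1 hs (hst.trans htL)) _
        (hmem1 (hs.trans hst) htL), abs_sub_comm, abs_of_nonneg (by linarith)]
    rcases le_total L s with hsL | hsL
    · rw [hc2 s hsL, hc2 t htL, h₂.geodesic _ (hmem2 hsL (hst.trans ht)) _ (hmem2 htL ht),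
        abs_sub_comm, abs_of_nonneg (by linarith)]
      ring
    rw [hc1 s hsL, hc2 t htL]
    have e1 := h₁.geodesic 0 (hmem1 le_rfl hL0) s (hmem1 hs hsL)
    have e2 := h₁.geodesic s (hmem1 hs hsL) L (hmem1 hL0 le_rfl)
    have e3 := h₂.geodesic 0 ⟨le_rfl, hr0⟩ (t - L) (hmem2 htL ht)
    have e4 := h₂.geodesic (t - L) (hmem2 htL ht) (dist y z) ⟨hr0, le_rfl⟩
    rw [h₁.source, abs_sub_comm, abs_of_nonneg (by linarith)] at e1
    rw [hL, h₁.target, ← hL, abs_sub_comm, abs_of_nonneg (by linarith)] at e2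
    rw [h₂.source, abs_sub_comm, abs_of_nonneg (by linarith)] at e3
    rw [h₂.target, abs_sub_comm, abs_of_nonneg (by linarith)] at e4
    have t1 := dist_triangle (c₁ s) y (c₂ (t - L))
    have t2 := dist_triangle4 x (c₁ s) (c₂ (t - L)) z
    linarith
  refine ⟨c, ⟨?_, ?_, ?_, ?_⟩, ?_⟩
  · intro s hs t ht
    rcases le_total s t with hst | hst
    · rw [hgeo s t hs.1 hst ht.2, abs_sub_comm, abs_of_nonneg (by linarith)]
    · rw [dist_comm, hgeo t s ht.1 hst hs.2, abs_of_nonneg (by linarith)]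
  · intro t ht
    rcases le_total t L with htL | htL
    · rw [hc1 t htL]; exact h₁.mapsTo (hmem1 ht.1 htL)
    · rw [hc2 t htL]; exact h₂.mapsTo (hmem2 htL ht.2)
  · rw [hc1 0 hL0, h₁.source]
  · rw [hc2 _ (by linarith), hadd, add_sub_cancel_left, h₂.target]
  · rw [hc1 _ le_rfl, hL, h₁.target]

theorem IsGeodesicOn.isLocalGeodesicOn {γ : ℝ → X} {I : Set ℝ} (h : IsGeodesicOn γ I) :
    IsLocalGeodesicOn γ I := fun _ _ => ⟨1, one_pos, h.mono inter_subset_left⟩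

namespace IsTinyBall

variable {κ : ℝ} {x₀ : X} {r₀ : ℝ}

/-- Geodesics in a tiny ball are extendible beyond their endpoint by the length `r₀`. -/
theorem exists_dist_eq_add (hU : IsTinyBall κ x₀ r₀) (hX : LocallyGeodesicallyComplete X)
    {x y : X} (hx : x ∈ Metric.ball x₀ r₀) (hy : y ∈ Metric.ball x₀ r₀) (hxy : x ≠ y) :
    ∃ z ∈ Metric.closedBall x₀ (10 * r₀), dist y z = r₀ ∧ dist x z = dist x y + dist y z := by
  have hr := hU.pos
  have hL : 0 < dist x y := dist_pos.2 hxy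
  rw [Metric.mem_ball] at hx hy
  have hL2 : dist x y < 2 * r₀ := by
    have := dist_triangle_right x y x₀; linarith
  have hY : ∀ {w : X}, dist x w ≤ dist x y + r₀ → w ∈ Metric.closedBall x₀ (10 * r₀) := by
    intro w hw
    have := dist_triangle_left w x₀ x
    rw [Metric.mem_closedBall]
    linarith
  set K : Set X := Metric.closedBall x₀ (10 * r₀) ∩
    {z | dist x y + dist y z = dist x z ∧ dist x z ≤ dist x y + r₀} with hKdef
  have hK : IsCompact K := by
    have h1 : IsClosed {z | dist x y + dist y z = dist x z} :=
      isClosed_eq (by fun_prop) (by fun_prop)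
    have h2 : IsClosed {z | dist x z ≤ dist x y + r₀} :=
      isClosed_le (by fun_prop) (by fun_prop)
    exact hU.compact.inter_right (h1.inter h2)
  have hyK : y ∈ K := ⟨hY (by linarith), by simp, by linarith⟩
  -- Local extensions come with no uniform length, so a farthest point beyond `y` is chosen by
  -- compactness; if it fell short of `r₀`, one more extension would go farther.
  obtain ⟨z, ⟨hzY, hz1, hz2⟩, hmax⟩ := hK.exists_isMaxOn ⟨y, hyK⟩
    (f := fun z => dist x z) (by fun_prop)
  suffices h : dist x z = dist x y + r₀ from ⟨z, hzY, by linarith, hz1.symm⟩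
  by_contra hne
  have hlt : dist x z < dist x y + r₀ := lt_of_le_of_ne hz2 hne
  have hxY := hY (w := x) (by rw [dist_self]; linarith)
  obtain ⟨c, hc⟩ := hU.exists_geodesic hxY hzY
  set T := dist x z with hT
  have hT0 : 0 < T := hL.trans_le (hmax hyK)
  obtain ⟨ε, hε, c', hcc', hc'⟩ := hX 0 T c hT0 hc.geodesic.isLocalGeodesicOn
  obtain ⟨δ, hδ, hgeo⟩ := hc' T ⟨by linarith, by linarith⟩
  obtain ⟨η, hη0, hη⟩ : ∃ η > 0, η ≤ ε ∧ η < δ ∧ η ≤ T ∧ η ≤ dist x y + r₀ - T := by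
    refine ⟨min (min ε (δ / 2)) (min T (dist x y + r₀ - T)), ?_, ?_, ?_, ?_, ?_⟩
    · have : 0 < dist x y + r₀ - T := by linarith
      positivity
    · exact (min_le_left _ _).trans (min_le_left _ _)
    · exact ((min_le_left _ _).trans (min_le_right _ _)).trans_lt (by linarith)
    · exact (min_le_right _ _).trans (min_le_left _ _)
    · exact (min_le_right _ _).trans (min_le_right _ _)
  obtain ⟨hηε, hηδ, hηT, hηr⟩ := hη
  have hgeo' : IsGeodesicOn c' (Icc (T - η) (T + η)) := hgeo.mono fun t ht =>
    ⟨⟨by linarith [ht.1], by linarith [ht.2]⟩, by linarith [ht.1], by linarith [ht.2]⟩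
  have hdx : ∀ t ∈ Icc 0 T, dist x (c' t) = t := by
    intro t ht
    rw [hcc' ht, ← hc.source, hc.geodesic 0 ⟨le_rfl, hT0.le⟩ t ht, abs_sub_comm, sub_zero,
      abs_of_nonneg ht.1]
  have hmemT : T ∈ Icc (T - η) (T + η) := ⟨by linarith, by linarith⟩
  have hTz : c' T = z := by rw [hcc' ⟨hT0.le, le_rfl⟩, hc.target]
  have hball : ∀ t ∈ Icc (T - η) (T + η), dist x (c' t) ≤ dist x y + r₀ := by
    intro t ht
    have h1 := dist_triangle x (c' T) (c' t)
    rw [hgeo' T hmemT t ht, hdx T ⟨hT0.le, le_rfl⟩] at h1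
    have : |T - t| ≤ η := abs_le.2 ⟨by linarith [ht.2], by linarith [ht.1]⟩
    linarith
  have hconv := hU.convexOn_dist hxY hgeo' fun t ht => hY (hball t ht)
  have hmem1 : T - η ∈ Icc (T - η) (T + η) := ⟨by linarith, by linarith⟩
  have hmem2 : T + η ∈ Icc (T - η) (T + η) := ⟨by linarith, by linarith⟩
  -- The values `T - η` and `T` at the left end and centre force at least `T + η` at the right end,
  -- so the local extension still minimizes distance from `x`.
  have hmid := hconv.2 hmem1 hmem2 (show (0 : ℝ) ≤ 1 / 2 by norm_num)
    (show (0 : ℝ) ≤ 1 / 2 by norm_num) (by norm_num)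
  simp only [smul_eq_mul] at hmid
  rw [show 1 / 2 * (T - η) + 1 / 2 * (T + η) = T by ring, hdx T ⟨hT0.le, le_rfl⟩,
    hdx (T - η) ⟨by linarith, by linarith⟩] at hmid
  have hzz : dist z (c' (T + η)) = η := by
    rw [← hTz, hgeo' T hmemT _ hmem2, abs_sub_comm, abs_of_nonneg (by linarith)]; ring
  have t1 := dist_triangle y z (c' (T + η))
  have t2 := dist_triangle x y (c' (T + η))
  have hle : dist x (c' (T + η)) ≤ T :=
    hmax ⟨hY (hball _ hmem2), by linarith, hball _ hmem2⟩
  linarith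

/-- Finitely many distance functions from points near a tiny ball almost determine the metric of
the tiny ball. -/
theorem exists_finset_le_abs_dist_sub (hU : IsTinyBall κ x₀ r₀)
    (hX : LocallyGeodesicallyComplete X) {ε : ℝ} (hε : 0 < ε) :
    ∃ P : Finset X, (∀ p ∈ P, p ∈ Metric.closedBall x₀ (10 * r₀)) ∧
      ∀ x ∈ Metric.ball x₀ r₀, ∀ y ∈ Metric.ball x₀ r₀, x ≠ y →
        ∃ p ∈ P, (1 - ε) * dist x y ≤ |dist p x - dist p y| := by
  have hr := hU.pos
  obtain ⟨P, hPY, hP, hcover⟩ :=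
    -- Convexity yields `r₀ (d(p,x) - d(p,y)) ≥ d(x,y) (d(p,y) - d(p,z))`, and the last factor is at
    -- least `r₀ - 2 d(p,z)`; hence the factor `1/2` in the radius.
    hU.compact.finite_cover_balls (e := ε * r₀ / 2) (by positivity)
  refine ⟨hP.toFinset, fun p hp => hPY (hP.mem_toFinset.1 hp), fun x hx y hy hxy => ?_⟩
  obtain ⟨z, hzY, hyz, hadd⟩ := hU.exists_dist_eq_add hX hx hy hxy
  obtain ⟨p, hp, hpz⟩ := mem_iUnion₂.1 (hcover hzY)
  refine ⟨p, hP.mem_toFinset.2 hp, le_trans ?_ (le_abs_self _)⟩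
  rw [Metric.mem_ball] at hpz
  have hsub : Metric.ball x₀ r₀ ⊆ Metric.closedBall x₀ (10 * r₀) :=
    Metric.ball_subset_closedBall.trans (Metric.closedBall_subset_closedBall (by linarith))
  obtain ⟨c₁, hc₁⟩ := hU.exists_geodesic (hsub hx) (hsub hy)
  obtain ⟨c₂, hc₂⟩ := hU.exists_geodesic (hsub hy) hzY
  obtain ⟨c, hc, hcy⟩ := hc₁.exists_concat hc₂ hadd
  have hconv := hU.convexOn_dist (hPY hp) hc.geodesic hc.mapsTo
  have hL : 0 < dist x y := dist_pos.2 hxy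
  rw [hyz] at hadd
  set L := dist x y
  have hT : 0 < dist x z := by linarith
  have h := hconv.2 (left_mem_Icc.2 hT.le) (right_mem_Icc.2 hT.le)
    (show 0 ≤ r₀ / dist x z by positivity) (show 0 ≤ L / dist x z by positivity)
    (by rw [← add_div, hadd, add_comm, div_self (by linarith)])
  simp only [smul_eq_mul, mul_zero, zero_add, hc.source, hc.target] at h
  rw [div_mul_cancel₀ _ hT.ne', hcy, div_mul_eq_mul_div, div_mul_eq_mul_div, ← add_div,
    le_div_iff₀ hT, hadd] at h
  have t1 := dist_triangle y p z
  rw [hyz, dist_comm y p] at t1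
  rw [dist_comm z p] at hpz
  have key : r₀ * ((1 - ε) * L) ≤ r₀ * (dist p x - dist p y) := by nlinarith
  exact le_of_mul_le_mul_left key hr

end IsTinyBall

end GCBA

/-! ### Slopes of convex functions along a partition -/

theorem ConvexOn.slope_le_slope {S : Set ℝ} {g : ℝ → ℝ} (hg : ConvexOn ℝ S g) {p q s t : ℝ}
    (hp : p ∈ S) (ht : t ∈ S) (hpq : p < q) (hqs : q ≤ s) (hst : s < t) :
    (g q - g p) / (q - p) ≤ (g t - g s) / (t - s) := by
  rcases hqs.eq_or_lt with rfl | hqs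
  · exact hg.slope_mono_adjacent hp ht hpq hst
  · have hq : q ∈ S := hg.1.ordConnected.out hp ht ⟨hpq.le, (hqs.trans hst).le⟩
    have hs : s ∈ S := hg.1.ordConnected.out hp ht ⟨(hpq.trans hqs).le, hst.le⟩
    exact (hg.slope_mono_adjacent hp hs hpq hqs).trans (hg.slope_mono_adjacent hq ht hqs hst)

/-- Along a partition, the slopes of a Lipschitz convex function in one interval are bounded by
its slopes on the two neighbouring intervals. -/
theorem ConvexOn.exists_slope_bounds {a b : ℝ} {g : ℝ → ℝ} {A : ℝ≥0}
    (hg : ConvexOn ℝ (Icc a b) g) (hA : LipschitzOnWith A g (Icc a b)) {u : ℕ → ℝ} {n : ℕ}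
    (hu : StrictMono u) (hmem : ∀ k ≤ n, u k ∈ Icc a b) :
    ∃ σ : ℕ → ℝ, (∀ k, |σ k| ≤ A) ∧
      ∀ k < n, ∀ s ∈ Icc (u k) (u (k + 1)), ∀ t ∈ Icc (u k) (u (k + 1)), s < t →
        σ k ≤ (g t - g s) / (t - s) ∧ (g t - g s) / (t - s) ≤ σ (k + 2) := by
  have hlip : ∀ s ∈ Icc a b, ∀ t ∈ Icc a b, s < t → |(g t - g s) / (t - s)| ≤ A := by
    intro s hs t ht hst
    have h := hA.dist_le_mul t ht s hs
    rw [Real.dist_eq, Real.dist_eq] at h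
    rw [abs_div, div_le_iff₀ (abs_pos.2 (sub_ne_zero.2 hst.ne'))]
    exact h
  have hsub : ∀ k < n, Icc (u k) (u (k + 1)) ⊆ Icc a b := fun k hk =>
    Icc_subset_Icc (hmem k hk.le).1 (hmem (k + 1) hk).2
  -- Indices are shifted by one: `σ (k + 1)` is the slope over the interval `k`, so `σ k` and `σ (k
  -- + 2)` belong to its neighbours. The values `-A` and `A` stand in for the missing neighbours at
  -- the ends.
  let σ : ℕ → ℝ
    | 0 => -A
    | k + 1 => if k < n then (g (u (k + 1)) - g (u k)) / (u (k + 1) - u k) else A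
  have hσ : ∀ k < n, σ (k + 1) = (g (u (k + 1)) - g (u k)) / (u (k + 1) - u k) :=
    fun k hk => if_pos hk
  have hσ' : ∀ k, n ≤ k → σ (k + 1) = A := fun k hk => if_neg (not_lt.2 hk)
  refine ⟨σ, ?_, ?_⟩
  · rintro (_ | k)
    · simp [σ]
    · rcases lt_or_ge k n with hk | hk
      · rw [hσ k hk]
        exact hlip _ (hmem k hk.le) _ (hmem (k + 1) hk) (hu k.lt_succ_self)
      · rw [hσ' k hk]; simp
  · intro k hk s hs t ht hst
    have hst' := abs_le.1 (hlip s (hsub k hk hs) t (hsub k hk ht) hst)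
    constructor
    · rcases k with _ | j
      · exact hst'.1
      · rw [hσ j (by omega)]
        exact hg.slope_le_slope (hmem j (by omega)) (hsub _ hk ht) (hu j.lt_succ_self) hs.1 hst
    · rcases lt_or_ge (k + 1) n with hk' | hk'
      · rw [hσ (k + 1) hk']
        exact hg.slope_le_slope (hsub _ hk hs) (hmem (k + 2) hk') hst ht.2
          (hu (k + 1).lt_succ_self)
      · rw [hσ' (k + 1) hk']; exact hst'.2

/-- Along a partition, the total oscillation of the slopes of a difference of two `A`-Lipschitz
convex functions is at most `8 * A`. -/
theorem exists_slope_oscillation_bound {a b : ℝ} {f g h : ℝ → ℝ} {A : ℝ≥0}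
    (hg : ConvexOn ℝ (Icc a b) g) (hgA : LipschitzOnWith A g (Icc a b))
    (hh : ConvexOn ℝ (Icc a b) h) (hhA : LipschitzOnWith A h (Icc a b))
    (hf : ∀ t ∈ Icc a b, f t = g t - h t) {u : ℕ → ℝ} {n : ℕ}
    (hu : StrictMono u) (hmem : ∀ k ≤ n, u k ∈ Icc a b) :
    ∃ ω : ℕ → ℝ, (∀ k < n, 0 ≤ ω k) ∧ ∑ k ∈ Finset.range n, ω k ≤ 8 * A ∧
      ∀ k < n, ∀ s ∈ Icc (u k) (u (k + 1)), ∀ t ∈ Icc (u k) (u (k + 1)), s < t →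
        |f t - f s| ≤ (|f (u (k + 1)) - f (u k)| / (u (k + 1) - u k) + ω k) * (t - s) := by
  obtain ⟨σ, hσA, hσ⟩ := hg.exists_slope_bounds hgA hu hmem
  obtain ⟨τ, hτA, hτ⟩ := hh.exists_slope_bounds hhA hu hmem
  have hends : ∀ k, u k ∈ Icc (u k) (u (k + 1)) ∧ u (k + 1) ∈ Icc (u k) (u (k + 1)) := fun k =>
    ⟨⟨le_rfl, (hu k.lt_succ_self).le⟩, (hu k.lt_succ_self).le, le_rfl⟩
  have hsum : ∀ ρ : ℕ → ℝ, (∀ k, |ρ k| ≤ A) →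
      ∑ k ∈ Finset.range n, (ρ (k + 2) - ρ k) ≤ 4 * A := by
    intro ρ hρ
    -- Differences with stride two telescope through sums of consecutive terms, leaving four
    -- boundary terms.
    have e := Finset.sum_range_sub (fun k => ρ (k + 1) + ρ k) n
    rw [Finset.sum_congr rfl fun k _ =>
      show ρ (k + 1 + 1) + ρ (k + 1) - (ρ (k + 1) + ρ k) = ρ (k + 2) - ρ k by ring] at e
    rw [e]
    have h1 := abs_le.1 (hρ (n + 1))
    have h2 := abs_le.1 (hρ n)
    have h3 := abs_le.1 (hρ 1)
    have h4 := abs_le.1 (hρ 0)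
    rw [zero_add]
    linarith
  refine ⟨fun k => (σ (k + 2) - σ k) + (τ (k + 2) - τ k), fun k hk => ?_, ?_, ?_⟩
  · have h1 := hσ k hk _ (hends k).1 _ (hends k).2 (hu k.lt_succ_self)
    have h2 := hτ k hk _ (hends k).1 _ (hends k).2 (hu k.lt_succ_self)
    simp only
    linarith
  · rw [Finset.sum_add_distrib]
    linarith [hsum σ hσA, hsum τ hτA]
  · intro k hk s hs t ht hst
    have hsub : Icc (u k) (u (k + 1)) ⊆ Icc a b :=
      Icc_subset_Icc (hmem k hk.le).1 (hmem (k + 1) hk).2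
    have hU : 0 < u (k + 1) - u k := sub_pos.2 (hu k.lt_succ_self)
    have hts : 0 < t - s := sub_pos.2 hst
    have slope_eq : ∀ s ∈ Icc (u k) (u (k + 1)), ∀ t ∈ Icc (u k) (u (k + 1)),
        (f t - f s) / (t - s) = (g t - g s) / (t - s) - (h t - h s) / (t - s) := by
      intro s hs t ht
      rw [hf t (hsub ht), hf s (hsub hs)]; ring
    have g1 := hσ k hk s hs t ht hst
    have h1 := hτ k hk s hs t ht hst
    have g2 := hσ k hk _ (hends k).1 _ (hends k).2 (hu k.lt_succ_self)
    have h2 := hτ k hk _ (hends k).1 _ (hends k).2 (hu k.lt_succ_self)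
    have e1 := slope_eq s hs t ht
    have e2 := slope_eq _ (hends k).1 _ (hends k).2
    have d1 := abs_div (f t - f s) (t - s)
    have d2 := abs_div (f (u (k + 1)) - f (u k)) (u (k + 1) - u k)
    rw [abs_of_pos hts] at d1
    rw [abs_of_pos hU] at d2
    rw [← div_le_iff₀ hts, ← d1, ← d2]
    have := abs_sub_abs_le_abs_sub ((f t - f s) / (t - s))
      ((f (u (k + 1)) - f (u k)) / (u (k + 1) - u k))
    have h3 : |(f t - f s) / (t - s) - (f (u (k + 1)) - f (u k)) / (u (k + 1) - u k)|
        ≤ (σ (k + 2) - σ k) + (τ (k + 2) - τ k) := by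
      rw [abs_le]; constructor <;> linarith
    linarith

/-! ### Uniform approximation of length by inscribed polygons -/

theorem LipschitzOnWith.eVariationOn_Icc_le {E : Type*} [PseudoEMetricSpace E] {γ : ℝ → E}
    {K : ℝ≥0} {s t : ℝ} (hst : s ≤ t) (h : LipschitzOnWith K γ (Icc s t)) :
    eVariationOn γ (Icc s t) ≤ K * ENNReal.ofReal (t - s) := by
  have h1 := h.comp_eVariationOn_le (mapsTo_id (Icc s t))
  have h2 := (monotone_id (α := ℝ)).monotoneOn (Icc s t)
  have h3 := h2.eVariationOn_eq (left_mem_Icc.2 hst) (right_mem_Icc.2 hst)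
  rw [inter_self] at h3
  exact h1.trans (by gcongr; exact h3.le)

/-- If the metric along a curve is determined up to the factor `η` by finitely many distance
functions, which are differences of `A`-Lipschitz convex functions along the curve, then inscribed
polygons approximate the length uniformly. -/
theorem eVariationOn_le_sum_dist_add {X : Type*} [MetricSpace X] {a b : ℝ} {γ : ℝ → X} {A : ℝ≥0}
    {P : Finset X} {η : ℝ} (hη : 0 < η)
    (hP : ∀ s ∈ Icc a b, ∀ t ∈ Icc a b, γ s ≠ γ t →
      ∃ p ∈ P, η * dist (γ s) (γ t) ≤ |dist p (γ s) - dist p (γ t)|)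
    (hdc : ∀ p ∈ P, ∃ g h : ℝ → ℝ, ConvexOn ℝ (Icc a b) g ∧ LipschitzOnWith A g (Icc a b) ∧
      ConvexOn ℝ (Icc a b) h ∧ LipschitzOnWith A h (Icc a b) ∧
      ∀ t ∈ Icc a b, dist p (γ t) = g t - h t)
    {u : ℕ → ℝ} {n : ℕ} {d : ℝ} (hd : 0 < d) (hu : ∀ k, u (k + 1) = u k + d)
    (hu0 : u 0 = a) (hun : u n = b) :
    ENNReal.ofReal η * eVariationOn γ (Icc a b) ≤ ENNReal.ofReal
      (∑ k ∈ Finset.range n, dist (γ (u k)) (γ (u (k + 1))) + d * (P.card * (8 * A))) := by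
  have hmono : StrictMono u := strictMono_nat_of_lt_succ fun k => by rw [hu]; linarith
  have hmem : ∀ k ≤ n, u k ∈ Icc a b := fun k hk =>
    ⟨hu0 ▸ hmono.monotone k.zero_le, hun ▸ hmono.monotone hk⟩
  have hω : ∀ p ∈ P, ∃ ω : ℕ → ℝ, (∀ k < n, 0 ≤ ω k) ∧ ∑ k ∈ Finset.range n, ω k ≤ 8 * A ∧
      ∀ k < n, ∀ s ∈ Icc (u k) (u (k + 1)), ∀ t ∈ Icc (u k) (u (k + 1)), s < t →
        |dist p (γ t) - dist p (γ s)| ≤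
          (|dist p (γ (u (k + 1))) - dist p (γ (u k))| / (u (k + 1) - u k) + ω k) * (t - s) := by
    intro p hp
    obtain ⟨g, h, hg, hgA, hh, hhA, hf⟩ := hdc p hp
    exact exists_slope_oscillation_bound (f := fun t => dist p (γ t)) hg hgA hh hhA hf hmono hmem
  choose! ω hω0 hωsum hω using hω
  -- The useful `p` depends on the pair of parameters, so the oscillations are summed over all of
  -- `P`; this costs the factor `P.card`.
  set Ω : ℕ → ℝ := fun k => ∑ p ∈ P, ω p k with hΩ
  have hΩ0 : ∀ k < n, 0 ≤ Ω k := fun k hk => Finset.sum_nonneg fun p hp => hω0 p hp k hk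
  have hstep : ∀ k < n, ENNReal.ofReal η * eVariationOn γ (Icc (u k) (u (k + 1))) ≤
      ENNReal.ofReal (dist (γ (u k)) (γ (u (k + 1))) + d * Ω k) := by
    intro k hk
    have hsub : Icc (u k) (u (k + 1)) ⊆ Icc a b :=
      Icc_subset_Icc (hmem k hk.le).1 (hmem (k + 1) hk).2
    -- On this interval `γ` is `B / η`-Lipschitz, so its length is at most `d * B / η`.
    set B := dist (γ (u k)) (γ (u (k + 1))) / d + Ω k with hB
    have hB0 : 0 ≤ B := add_nonneg (by positivity) (hΩ0 k hk)
    have hlt : ∀ s ∈ Icc (u k) (u (k + 1)), ∀ t ∈ Icc (u k) (u (k + 1)), s < t →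
        dist (γ s) (γ t) ≤ B / η * (t - s) := by
      intro s hs t ht hst
      have hts : 0 < t - s := sub_pos.2 hst
      rcases eq_or_ne (γ s) (γ t) with h | h
      · rw [h, dist_self]; positivity
      obtain ⟨p, hp, hle⟩ := hP s (hsub hs) t (hsub ht) h
      rw [abs_sub_comm] at hle
      have h1 := hle.trans (hω p hp k hk s hs t ht hst)
      have h2 : |dist p (γ (u (k + 1))) - dist p (γ (u k))| ≤ dist (γ (u k)) (γ (u (k + 1))) := by
        rw [dist_comm (γ (u k)), dist_comm p, dist_comm p]
        exact abs_dist_sub_le _ _ _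
      have h3 : ω p k ≤ Ω k :=
        Finset.single_le_sum (f := fun p => ω p k) (fun q hq => hω0 q hq k hk) hp
      rw [show u (k + 1) - u k = d by rw [hu]; ring] at h1
      have h4 : |dist p (γ (u (k + 1))) - dist p (γ (u k))| / d + ω p k ≤ B := by
        rw [hB]; gcongr
      have h5 : η * dist (γ s) (γ t) ≤ B * (t - s) :=
        h1.trans (mul_le_mul_of_nonneg_right h4 hts.le)
      rw [div_mul_eq_mul_div, le_div_iff₀ hη, mul_comm _ η]
      exact h5
    have hlip : LipschitzOnWith (B / η).toNNReal γ (Icc (u k) (u (k + 1))) := by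
      refine LipschitzOnWith.of_dist_le_mul fun s hs t ht => ?_
      rw [Real.coe_toNNReal _ (by positivity), Real.dist_eq]
      rcases lt_trichotomy s t with h | rfl | h
      · rw [abs_sub_comm, abs_of_pos (sub_pos.2 h)]; exact hlt s hs t ht h
      · simp
      · rw [abs_of_pos (sub_pos.2 h), dist_comm]; exact hlt t ht s hs h
    refine (mul_le_mul_right (hlip.eVariationOn_Icc_le (by rw [hu]; linarith)) _).trans ?_
    rw [show ((B / η).toNNReal : ℝ≥0∞) = ENNReal.ofReal (B / η) from rfl,
      ← ENNReal.ofReal_mul (by positivity), ← ENNReal.ofReal_mul hη.le]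
    apply ENNReal.ofReal_le_ofReal
    rw [show u (k + 1) - u k = d by rw [hu]; ring, hB]
    apply le_of_eq
    field_simp
  have hsum := eVariationOn.sum' γ hmono.monotone (n := n)
  rw [hu0, hun] at hsum
  rw [← hsum, Finset.mul_sum]
  calc _ ≤ ∑ k ∈ Finset.range n,
        ENNReal.ofReal (dist (γ (u k)) (γ (u (k + 1))) + d * Ω k) :=
        Finset.sum_le_sum fun k hk => hstep k (Finset.mem_range.1 hk)
    _ = ENNReal.ofReal
        (∑ k ∈ Finset.range n, (dist (γ (u k)) (γ (u (k + 1))) + d * Ω k)) := by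
        rw [ENNReal.ofReal_sum_of_nonneg]
        intro k hk
        have := hΩ0 k (Finset.mem_range.1 hk)
        positivity
    _ ≤ _ := by
        apply ENNReal.ofReal_le_ofReal
        rw [Finset.sum_add_distrib, ← Finset.mul_sum]
        gcongr
        rw [hΩ, Finset.sum_comm]
        have := Finset.sum_le_card_nsmul P (fun p => ∑ k ∈ Finset.range n, ω p k) (8 * A) hωsum
        simpa using this

theorem sum_dist_le_toReal_eVariationOn {X : Type*} [MetricSpace X] {γ : ℝ → X} {S : Set ℝ}
    (hγ : eVariationOn γ S ≠ ⊤) {u : ℕ → ℝ} {n : ℕ} (hu : Monotone u) (hmem : ∀ k ≤ n, u k ∈ S) :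
    ∑ k ∈ Finset.range n, dist (γ (u k)) (γ (u (k + 1))) ≤ (eVariationOn γ S).toReal := by
  have h := eVariationOn.sum_le_of_monotoneOn_Iic (f := γ) (n := n) (hu.monotoneOn _) hmem
  have e : ∑ k ∈ Finset.range n, edist (γ (u (k + 1))) (γ (u k))
      = ENNReal.ofReal (∑ k ∈ Finset.range n, dist (γ (u k)) (γ (u (k + 1)))) := by
    rw [ENNReal.ofReal_sum_of_nonneg fun _ _ => dist_nonneg]
    exact Finset.sum_congr rfl fun k _ => by rw [edist_comm, edist_dist]
  rw [e] at h
  exact (ENNReal.ofReal_le_iff_le_toReal hγ).1 h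

/-! ### Passage to the limit -/

theorem proposition14 {X : Type*} [MetricSpace X] (κ : ℝ) (hX : GCBA.IsGCBA X κ)
    (x₀ : X) (r₀ : ℝ) (hU : GCBA.IsTinyBall κ x₀ r₀)
    (a b : ℝ) (hab : a ≤ b) (A : ℝ≥0) (γ : ℕ → ℝ → X) (γ_lim : ℝ → X)
    (hγ : ∀ l, GCBA.IsDCCurve (Metric.ball x₀ r₀) A a b (γ l))
    (hlim : ∀ t ∈ Icc a b, Tendsto (fun l => γ l t) atTop (𝓝 (γ_lim t))) :
    Tendsto (fun l => GCBA.curveLength (γ l) a b) atTop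
      (𝓝 (GCBA.curveLength γ_lim a b)) := by
  unfold GCBA.curveLength
  rcases hab.eq_or_lt with rfl | hab
  · simp [eVariationOn.subsingleton]
  refine tendsto_order.2 ⟨fun c hc => eVariationOn.lowerSemicontinuous_aux hlim hc, fun c hc => ?_⟩
  obtain ⟨r, hr, hrc⟩ := ENNReal.lt_iff_exists_nnreal_btwn.1 hc
  have hfin : eVariationOn γ_lim (Icc a b) ≠ ⊤ := (hr.trans_le le_top).ne
  set V := (eVariationOn γ_lim (Icc a b)).toReal with hV
  have hV0 : 0 ≤ V := ENNReal.toReal_nonneg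
  have hVr : V < r := by
    have := (ENNReal.toReal_lt_toReal hfin ENNReal.coe_ne_top).2 hr
    simpa using this
  have hr0 : (0 : ℝ) < r := hV0.trans_lt hVr
  -- With this `ε`, the bound `η * ℓ(γ_l) < (r + V) / 2` is exactly `ℓ(γ_l) < r`.
  have hε : 0 < (r - V) / (2 * r) := div_pos (by linarith) (by linarith)
  obtain ⟨P, hPY, hP⟩ :=
    hU.exists_finset_le_abs_dist_sub hX.locallyGeodesicallyComplete hε
  have hη_eq : (1 - (r - V) / (2 * r)) * r = (r + V) / 2 := by field_simp; ring
  set η := 1 - (r - V) / (2 * r) with hη_def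
  have hη : 0 < η := by
    by_contra hneg
    nlinarith
  set C : ℝ := (b - a) * (P.card * (8 * A))
  -- The mesh `(b - a) / n` makes the polygon error `C / n` less than `(r - V) / 2`, the gap between
  -- `V` and `(r + V) / 2`.
  obtain ⟨n, hn⟩ := exists_nat_gt (max 0 (2 * C / (r - V)))
  have hn0 : (0 : ℝ) < n := (le_max_left _ _).trans_lt hn
  have hnC : 2 * C / (r - V) < n := (le_max_right _ _).trans_lt hn
  set d := (b - a) / n with hd_def
  have hd : 0 < d := div_pos (by linarith) hn0
  set u : ℕ → ℝ := fun k => a + k * d with hu_def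
  have hu : ∀ k, u (k + 1) = u k + d := fun k => by simp only [hu_def]; push_cast; ring
  have hu0 : u 0 = a := by simp [hu_def]
  have hun : u n = b := by simp only [hu_def, hd_def]; field_simp; ring
  have hmono : Monotone u := monotone_nat_of_le_succ fun k => by rw [hu]; linarith
  have hmem : ∀ k ≤ n, u k ∈ Icc a b := fun k hk =>
    ⟨hu0 ▸ hmono k.zero_le, hun ▸ hmono hk⟩
  have herr : d * (P.card * (8 * A)) < (r - V) / 2 := by
    have : d * (P.card * (8 * A)) = C / n := by rw [hd_def]; ring
    rw [this, div_lt_iff₀ hn0]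
    rw [div_lt_iff₀ (by linarith)] at hnC
    linarith
  have hsum := sum_dist_le_toReal_eVariationOn hfin hmono hmem
  have htend : Tendsto (fun l => ∑ k ∈ Finset.range n, dist (γ l (u k)) (γ l (u (k + 1)))) atTop
      (𝓝 (∑ k ∈ Finset.range n, dist (γ_lim (u k)) (γ_lim (u (k + 1))))) := by
    refine tendsto_finsetSum _ fun k hk => ?_
    have hk := Finset.mem_range.1 hk
    exact (hlim _ (hmem k hk.le)).dist (hlim _ (hmem (k + 1) hk))
  have hev := htend.eventually_lt_const
    (show _ < (r + V) / 2 - d * (P.card * (8 * A)) by linarith)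
  filter_upwards [hev] with l hl
  have hdc := hγ l
  have hmain := eVariationOn_le_sum_dist_add (γ := γ l) (A := A) (P := P) hη
    (fun s hs t ht hst => hP _ (hdc.mapsTo hs) _ (hdc.mapsTo ht) hst)
    (fun p hp => hdc.dc _ (LipschitzWith.dist_right p).lipschitzOnWith
      (hU.geodConvexOn_dist (hPY p hp))) hd hu hu0 hun
  refine lt_trans ?_ hrc
  have hlt : ENNReal.ofReal η * eVariationOn (γ l) (Icc a b) < ENNReal.ofReal η * r := by
    refine hmain.trans_lt ?_
    rw [← ENNReal.ofReal_coe_nnreal, ← ENNReal.ofReal_mul hη.le, hη_eq]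
    exact (ENNReal.ofReal_lt_ofReal_iff (by linarith)).2 (by linarith)
  exact lt_of_mul_lt_mul_left hlt (by simp)
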